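/- Let $K\ge 2$, $\alpha>0$, $P_s>0$, $R_e>0$, $\lambda_e>0$, and let $s_1,\dots,s_K\in\mathbb R^2$ be the locations of $K$ base stations. Let the locations $(e_j)_{j\in\mathbb N}$ of the eavesdroppers be the points of a homogeneous Poisson point process on $\mathbb R^2$ with density $\lambda_e$, and let the fading coefficients $h_{s_k,o}$ ($1\le k\le K$) from the base stations to the user and $h_{s_k,e_j}$ ($1\le k\le K$, $j\in\mathbb N$) from the base stations to the eavesdroppers be independent circularly symmetric complex Gaussian random variables with mean $0$ and variance $1$ (so $\mathbb E|h|^2=1$), jointly independent of $(e_j)_j$. Write $r_{s_k,e_j}=|s_k-e_j|$. In the distributed beamforming (DBF) scheme the signal-to-noise ratio (SNR) at the $j$-th eavesdropper is $$\gamma_{e_j}=P_s\Bigl|\sum_{k=1}^K\frac{\overline{h_{s_k,o}}\,h_{s_k,e_j}}{|h_{s_k,o}|}\,r_{s_k,e_j}^{-\alpha/2}\Bigr|^2,$$ and in the frequency-domain orthogonal transmission (FOT) scheme the SNR at the $j$-th eavesdropper of the signal of the $k$-th base station is $$\gamma_{s_k,e_j}=KP_s\,|h_{s_k,e_j}|^2\,r_{s_k,e_j}^{-\alpha}.$$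 The secrecy outage probabilities of the two schemes with rate redundancy $R_e$ are $$\mathcal O_{so}^{\rm D}=\mathbb P\bigl\{\exists j:\ \log_2(1+\gamma_{e_j})>R_e\bigr\},\qquad \mathcal O_{so}^{\rm F}=1-\mathbb P\bigl\{\forall j\ \forall k:\ \log_2(1+\gamma_{s_k,e_j})\le R_e\bigr\}.$$ Then the FOT scheme has a strictly larger secrecy outage probability than the DBF scheme: $\mathcal O_{so}^{\rm F}>\mathcal O_{so}^{\rm D}$. -/

import Mathlib

open MeasureTheory ProbabilityTheory
open scoped ENNReal NNReal ComplexConjugate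

noncomputable section

namespace SecureCaching

/-- The two-dimensional Euclidean plane. -/
abbrev Plane : Type := EuclideanSpace ℝ (Fin 2)

/-- The standard circularly symmetric complex Gaussian law: real and imaginary part are independent
real Gaussians of mean `0` and variance `1 / 2` (so the law has mean `0` and `𝔼 |h| ^ 2 = 1`). -/
def complexGaussian : Measure ℂ :=
  ((gaussianReal 0 (1 / 2)).prod (gaussianReal 0 (1 / 2))).map
    (fun p : ℝ × ℝ => (⟨p.1, p.2⟩ : ℂ))

/-- The random measure `Φ` is a Poisson point process with intensity measure `Λ`: the number of
points in a measurable set `B` of finite intensity is Poisson distributed with mean `Λ B`, and the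
numbers of points in pairwise disjoint measurable sets are independent. -/
structure IsPoissonPointProcess {Ω E : Type*} [MeasurableSpace Ω] [MeasurableSpace E]
    (Φ : Ω → Measure E) (Λ : Measure E) (μ : Measure Ω) : Prop where
  measurable : Measurable Φ
  map_count : ∀ B : Set E, MeasurableSet B → Λ B ≠ ∞ →
    μ.map (fun ω => Φ ω B) = (poissonMeasure (Λ B).toNNReal).map (fun n : ℕ => (n : ℝ≥0∞))
  indep_count : ∀ (n : ℕ) (B : Fin n → Set E), (∀ i, MeasurableSet (B i)) →
    Pairwise (fun i j => Disjoint (B i) (B j)) → iIndepFun (fun i ω => Φ ω (B i)) μ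

/-- The counting measure `∑ j, δ_(x j)` of a sequence of points. -/
def pointMeasure (x : ℕ → Plane) : Measure Plane :=
  Measure.sum (fun j => Measure.dirac (x j))

/-- The capacity `log₂ (1 + γ)` of a channel with signal-to-noise ratio `γ`. -/
def capacity (γ : ℝ) : ℝ := Real.logb 2 (1 + γ)

variable {K : ℕ}

/-- SNR, under distributed beamforming (DBF), of an eavesdropper at `x`, where `s k` is the location
of the `k`-th base station, `ho k` its fading coefficient to the user and `hx k` its fading
coefficient to the eavesdropper. -/
def dbfSNR (α P : ℝ) (s : Fin K → Plane) (ho hx : Fin K → ℂ) (x : Plane) : ℝ :=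
  P * ‖∑ k, (conj (ho k) * hx k / (‖ho k‖ : ℂ)) * ((dist (s k) x ^ (-α / 2) : ℝ) : ℂ)‖ ^ 2

/-- SNR, under frequency-domain orthogonal transmission (FOT), of the signal of the `k`-th base
station at an eavesdropper at `x`. -/
def fotSNR (α P : ℝ) (s : Fin K → Plane) (hx : Fin K → ℂ) (x : Plane) (k : Fin K) : ℝ :=
  K * P * ‖hx k‖ ^ 2 * dist (s k) x ^ (-α)

variable {Ω : Type*} [MeasurableSpace Ω]

/-- Secrecy outage probability of DBF with rate redundancy `Re`: the probability that the wiretap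
capacity of some eavesdropper (equivalently, of the strongest one) exceeds `Re`. Here `e j` is the
location of the `j`-th eavesdropper and `he k j` the fading coefficient from the `k`-th base station
to the `j`-th eavesdropper. -/
def dbfSOP (μ : Measure Ω) (α P Re : ℝ) (s : Fin K → Plane) (e : ℕ → Ω → Plane)
    (ho : Fin K → Ω → ℂ) (he : Fin K → ℕ → Ω → ℂ) : ℝ :=
  μ.real {ω | ∃ j, Re < capacity (dbfSNR α P s (fun k => ho k ω) (fun k => he k j ω) (e j ω))}

/-- Secrecy outage probability of FOT with rate redundancy `Re`: the complement of the probability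
that no eavesdropper has, on any of the `K` orthogonal channels, a wiretap capacity exceeding
`Re`. -/
def fotSOP (μ : Measure Ω) (α P Re : ℝ) (s : Fin K → Plane) (e : ℕ → Ω → Plane)
    (he : Fin K → ℕ → Ω → ℂ) : ℝ :=
  1 - μ.real {ω | ∀ j k, capacity (fotSNR α P s (fun i => he i j ω) (e j ω) k) ≤ Re}

end SecureCaching

end

namespace SecureCaching

/-! Fix the eavesdropper locations and the fading to the user, and compare the probabilities of no
outage. Under DBF the amplitude at `x` is a linear combination of independent complex Gaussians,
hence complex Gaussian, and its power has mean at most `P * ∑ k, dist (s k) x ^ (-α)`. This is at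
most `K * P` times the largest path gain, which is the mean FOT power on the strongest channel. So
DBF avoids outage at `x` with probability at least `minPowerCDF`, the least of the FOT
single-channel probabilities (`minPowerCDF_le_dbf`). FOT needs all `K ≥ 2` independent channels to
succeed; away from the base stations each has success probability below one, so the product is
strictly below that minimum (`fot_lt_minPowerCDF`).

Given the locations, eavesdroppers contribute independent factors. Strictness at eavesdropper `0`
alone survives the infinite product provided the product of the minima is not zero, that is,
provided `∑' j, (1 - minPowerCDF ..)` converges. It does almost surely, by Campbell's formula
(`IsPoissonPointProcess.sum_map_eq`) and integrability over the plane
(`lintegral_one_sub_powerCDF_ne_top`). Integrating over the locations gives the theorem. -/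

/-! ### Infinite products of probabilities -/

theorem infinitePi_univ_pi_eq_iInf {X : ℕ → Type*} [∀ j, MeasurableSpace (X j)]
    (ν : ∀ j, Measure (X j)) [∀ j, IsProbabilityMeasure (ν j)] {t : ∀ j, Set (X j)}
    (ht : ∀ j, MeasurableSet (t j)) :
    Measure.infinitePi ν (Set.univ.pi t) = ⨅ n, ∏ j ∈ Finset.range n, ν j (t j) := by
  have h : Set.univ.pi t = ⋂ n, Set.pi (Finset.range n : Set ℕ) t := by
    ext x
    simp only [Set.mem_pi, Set.mem_univ, forall_true_left, Set.mem_iInter, Finset.coe_range,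
      Set.mem_Iio]
    exact ⟨fun h n i _ => h i, fun h i => h (i + 1) i i.lt_succ_self⟩
  rw [h, measure_iInter_eq_iInf_measure_iInter_le]
  · refine iInf_congr fun n => ?_
    rw [← Measure.infinitePi_pi ν (fun j _ => ht j)]
    congr 1
    ext x
    simp only [Set.mem_pi, Set.mem_iInter, Finset.coe_range, Set.mem_Iio]
    exact ⟨fun h i hi => h n le_rfl i hi, fun h m hm i hi => h i (hi.trans_le hm)⟩
  · exact fun n => (MeasurableSet.pi (Finset.countable_toSet _) fun j _ => ht j).nullMeasurableSet
  · exact ⟨0, measure_ne_top _ _⟩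

theorem iInf_prod_ne_zero {q : ℕ → ℝ≥0∞} (hq1 : ∀ j, q j ≤ 1) (hq0 : ∀ j, q j ≠ 0)
    (hsum : ∑' j, (1 - q j) ≠ ∞) : (⨅ n, ∏ j ∈ Finset.range n, q j) ≠ 0 := by
  have htop : ∀ j, q j ≠ ∞ := fun j => ((hq1 j).trans_lt ENNReal.one_lt_top).ne
  set f : ℕ → ℝ := fun j => (q j).toReal - 1 with hf
  have hfs : Summable f := by
    have h := (ENNReal.summable_toReal hsum).neg
    refine h.congr fun j => ?_
    rw [ENNReal.toReal_sub_of_le (hq1 j) ENNReal.one_ne_top]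
    simp [hf]
  have hne : ∏' j, (1 + f j) ≠ 0 := by
    refine tprod_one_add_ne_zero_of_summable (fun j => ?_) hfs.norm
    simpa [hf, ENNReal.toReal_eq_zero_iff, htop] using hq0 j
  have hmul : Multipliable fun j => 1 + f j := multipliable_one_add_of_summable hfs.norm
  have hlim : Filter.Tendsto (fun n => ∏ j ∈ Finset.range n, q j) Filter.atTop
      (nhds (ENNReal.ofReal (∏' j, (1 + f j)))) := by
    refine (ENNReal.tendsto_ofReal hmul.hasProd.tendsto_prod_nat).congr fun n => ?_
    rw [ENNReal.ofReal_prod_of_nonneg]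
    · exact Finset.prod_congr rfl fun j _ => by simp [hf, ENNReal.ofReal_toReal (htop j)]
    · intro j _; simp [hf]
  have hanti : Antitone fun n => ∏ j ∈ Finset.range n, q j := antitone_nat_of_succ_le fun n => by
    rw [Finset.prod_range_succ]
    exact mul_le_of_le_one_right' (hq1 n)
  rw [tendsto_nhds_unique (tendsto_atTop_iInf hanti) hlim, ne_eq, ENNReal.ofReal_eq_zero, not_le]
  refine lt_of_le_of_ne (ge_of_tendsto' hmul.hasProd.tendsto_prod_nat fun n =>
    Finset.prod_nonneg fun j _ => by simp [hf]) hne.symm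

/-- The factor `f 0 / q 0 < 1` can be pulled out of the whole product; it makes a strict difference
because the remaining infinite product is nonzero. -/
theorem iInf_prod_lt_iInf_prod {f q : ℕ → ℝ≥0∞} (hfq : ∀ j, f j ≤ q j) (h0 : f 0 < q 0)
    (hq1 : ∀ j, q j ≤ 1) (hq0 : ∀ j, q j ≠ 0) (hsum : ∑' j, (1 - q j) ≠ ∞) :
    ⨅ n, ∏ j ∈ Finset.range n, f j < ⨅ n, ∏ j ∈ Finset.range n, q j := by
  have hne := iInf_prod_ne_zero hq1 hq0 hsum
  have hle1 : (⨅ n, ∏ j ∈ Finset.range n, q j) ≤ 1 := (iInf_le _ 0).trans (by simp)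
  have hq0t : q 0 ≠ ∞ := ((hq1 0).trans_lt ENNReal.one_lt_top).ne
  have hc : f 0 / q 0 < 1 := by
    rw [ENNReal.div_lt_iff (Or.inl (hq0 0)) (Or.inl hq0t), one_mul]; exact h0
  have key : ⨅ n, ∏ j ∈ Finset.range n, f j ≤ f 0 / q 0 * ⨅ n, ∏ j ∈ Finset.range n, q j := by
    rw [ENNReal.mul_iInf (fun h => absurd h (hc.trans ENNReal.one_lt_top).ne)]
    -- The range is enlarged to `n + 1` so that the factor of index `0` is always present.
    refine le_iInf fun n => (iInf_le _ (n + 1)).trans ?_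
    have h1 : ∏ j ∈ Finset.range (n + 1), f j ≤ f 0 / q 0 * ∏ j ∈ Finset.range (n + 1), q j := by
      rw [Finset.prod_range_succ', Finset.prod_range_succ', mul_left_comm,
        ENNReal.div_mul_cancel (hq0 0) hq0t]
      gcongr with j _
      exact hfq _
    refine h1.trans (mul_le_mul_right ?_ _)
    rw [Finset.prod_range_succ]
    exact mul_le_of_le_one_right' (hq1 n)
  refine key.trans_lt ?_
  calc _ < 1 * _ := ENNReal.mul_lt_mul_left hne (hle1.trans_lt ENNReal.one_lt_top).ne hc
    _ = _ := one_mul _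

/-! ### Intensity of a Poisson process -/

theorem lintegral_natCast_poissonMeasure (r : ℝ≥0) :
    ∫⁻ n, (n : ℝ≥0∞) ∂(poissonMeasure r) = r := by
  have h1 : ∑' n : ℕ, ENNReal.ofReal (Real.exp (-r) * r ^ n / n.factorial) = 1 := by
    rw [← ENNReal.ofReal_tsum_of_nonneg (fun n => by positivity)
      (hasSum_one_poissonMeasure r).summable, (hasSum_one_poissonMeasure r).tsum_eq]
    simp
  rw [poissonMeasure, lintegral_sum_measure]
  simp only [lintegral_smul_measure, lintegral_dirac, smul_eq_mul]
  rw [tsum_eq_zero_add' ENNReal.summable]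
  have h2 : ∀ n : ℕ, ENNReal.ofReal (Real.exp (-r) * r ^ (n + 1) / (n + 1).factorial)
      * ((n + 1 : ℕ) : ℝ≥0∞) = ENNReal.ofReal (Real.exp (-r) * r ^ n / n.factorial) * r := by
    intro n
    rw [← ENNReal.ofReal_natCast (n + 1), ← ENNReal.ofReal_coe_nnreal, ← ENNReal.ofReal_mul
      (by positivity), ← ENNReal.ofReal_mul (by positivity)]
    congr 1
    rw [Nat.factorial_succ]
    push_cast
    field_simp
    ring
  simp_rw [h2]
  rw [ENNReal.tsum_mul_right, h1]
  simp

/-- Campbell's formula: both sides give the expected number of points in a set. It holds for any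
enumeration of the points, so nothing is needed about the laws of the individual `e j`. -/
theorem IsPoissonPointProcess.sum_map_eq {Ω : Type*} [MeasurableSpace Ω] {μ : Measure Ω}
    {Λ : Measure Plane} [SigmaFinite Λ] {e : ℕ → Ω → Plane} (he : ∀ j, Measurable (e j))
    (h : IsPoissonPointProcess (fun ω => pointMeasure (fun j => e j ω)) Λ μ) :
    Measure.sum (fun j => μ.map (e j)) = Λ := by
  have hfin : ∀ B, MeasurableSet B → Λ B ≠ ∞ → Measure.sum (fun j => μ.map (e j)) B = Λ B := by
    intro B hB hBt
    have hm : Measurable fun ω => pointMeasure (fun j => e j ω) B :=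
      (Measure.measurable_coe hB).comp h.measurable
    calc Measure.sum (fun j => μ.map (e j)) B
        = ∑' j, ∫⁻ ω, B.indicator 1 (e j ω) ∂μ := by
          rw [Measure.sum_apply _ hB]
          refine tsum_congr fun j => ?_
          rw [← lintegral_map (measurable_one.indicator hB) (he j), lintegral_indicator_one hB]
      _ = ∫⁻ ω, pointMeasure (fun j => e j ω) B ∂μ := by
          rw [← lintegral_tsum (f := fun j ω => B.indicator 1 (e j ω)) fun j =>
            ((measurable_one.indicator hB).comp (he j)).aemeasurable]
          refine lintegral_congr fun ω => ?_
          rw [pointMeasure, Measure.sum_apply _ hB]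
          exact tsum_congr fun j => (Measure.dirac_apply' _ hB).symm
      _ = ∫⁻ y, y ∂(μ.map fun ω => pointMeasure (fun j => e j ω) B) :=
          (lintegral_map measurable_id hm).symm
      _ = Λ B := by
          rw [h.map_count B hB hBt, lintegral_map (f := fun y => y) measurable_id
            (measurable_of_countable _)]
          rw [lintegral_natCast_poissonMeasure, ENNReal.coe_toNNReal hBt]
  ext B hB
  -- Counts are controlled only on sets of finite intensity, so `B` is cut into countably many such
  -- pieces.
  have hd : ∀ n, MeasurableSet (disjointed (spanningSets Λ) n) :=
    MeasurableSet.disjointed (measurableSet_spanningSets Λ)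
  have hU : B = ⋃ n, B ∩ disjointed (spanningSets Λ) n := by
    rw [← Set.inter_iUnion, iUnion_disjointed, iUnion_spanningSets, Set.inter_univ]
  have hdis : Pairwise (Function.onFun Disjoint fun n => B ∩ disjointed (spanningSets Λ) n) :=
    fun i j hij => ((disjoint_disjointed _) hij).mono Set.inter_subset_right Set.inter_subset_right
  rw [hU, measure_iUnion hdis fun n => hB.inter (hd n),
    measure_iUnion hdis fun n => hB.inter (hd n)]
  refine tsum_congr fun n => hfin _ (hB.inter (hd n)) (ne_top_of_le_ne_top
    (measure_spanningSets_lt_top Λ n).ne (measure_mono ?_))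
  exact Set.inter_subset_right.trans (disjointed_subset _ _)

/-! ### Independence and joint laws -/

theorem IndepFun.measure_preimage_prodMk {Ω A B : Type*} [MeasurableSpace Ω] [MeasurableSpace A]
    [MeasurableSpace B] {μ : Measure Ω} [IsFiniteMeasure μ] {X : Ω → A} {Y : Ω → B}
    (hX : Measurable X) (hY : Measurable Y) (h : IndepFun X Y μ) {S : Set (A × B)}
    (hS : MeasurableSet S) :
    μ {ω | (X ω, Y ω) ∈ S} = ∫⁻ x, μ.map Y (Prod.mk x ⁻¹' S) ∂(μ.map X) := by
  have h1 : μ {ω | (X ω, Y ω) ∈ S} = μ.map (fun ω => (X ω, Y ω)) S :=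
    (Measure.map_apply (hX.prodMk hY) hS).symm
  rw [h1, h.map_prod_eq_prod_map_map hX.aemeasurable hY.aemeasurable, Measure.prod_apply hS]

theorem iIndepFun.indepFun_inl_inr {Ω ι κ A : Type*} [MeasurableSpace Ω] [MeasurableSpace A]
    {μ : Measure Ω} {X : ι → Ω → A} {Y : κ → Ω → A}
    (hX : ∀ i, Measurable (X i)) (hY : ∀ i, Measurable (Y i))
    (h : iIndepFun (Sum.elim X Y : ι ⊕ κ → Ω → A) μ) :
    IndepFun (fun ω i => X i ω) (fun ω i => Y i ω) μ := by
  have hle : ∀ i : ι ⊕ κ, MeasurableSpace.comap (Sum.elim X Y i) inferInstance ≤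
      ‹MeasurableSpace Ω› := by
    rintro (i | i)
    · exact (hX i).comap_le
    · exact (hY i).comap_le
  have hdis : Disjoint (Set.range (Sum.inl : ι → ι ⊕ κ)) (Set.range Sum.inr) :=
    Set.isCompl_range_inl_range_inr.disjoint
  have hI := indep_iSup_of_disjoint hle h.iIndep hdis
  refine indep_of_indep_of_le_left (indep_of_indep_of_le_right hI ?_) ?_
  · refine @Measurable.comap_le _ _ (_) _ _ ((@measurable_pi_iff _ _ _ (_) _ _).2 fun i => ?_)
    exact @Measurable.of_comap_le _ _ (_) _ _
      (le_iSup₂ (f := fun (j : ι ⊕ κ) (_ : j ∈ Set.range Sum.inr) =>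
        MeasurableSpace.comap (Sum.elim X Y j) inferInstance) (Sum.inr i) ⟨i, rfl⟩)
  · refine @Measurable.comap_le _ _ (_) _ _ ((@measurable_pi_iff _ _ _ (_) _ _).2 fun i => ?_)
    exact @Measurable.of_comap_le _ _ (_) _ _
      (le_iSup₂ (f := fun (j : ι ⊕ κ) (_ : j ∈ Set.range Sum.inl) =>
        MeasurableSpace.comap (Sum.elim X Y j) inferInstance) (Sum.inl i) ⟨i, rfl⟩)

/-- Regroups the fading array by eavesdropper, so that the vectors of coefficients seen by different
eavesdroppers become the factors of a product measure. -/
theorem iIndepFun.map_swap_eq_infinitePi {Ω ι κ A : Type*} [MeasurableSpace Ω] [MeasurableSpace A]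
    [Fintype ι] {μ : Measure Ω} {γ : Measure A} [IsProbabilityMeasure γ] {Y : ι → κ → Ω → A}
    (hY : ∀ i j, Measurable (Y i j)) (hlaw : ∀ i j, μ.map (Y i j) = γ)
    (h : iIndepFun (fun (p : ι × κ) => Y p.1 p.2) μ) :
    μ.map (fun ω j i => Y i j ω) =
      Measure.infinitePi (fun _ : κ => Measure.pi fun _ : ι => γ) := by
  have := h.isProbabilityMeasure
  have h' : iIndepFun (fun (p : κ × ι) => Y p.2 p.1) μ :=
    h.precomp (g := Prod.swap) Prod.swap_injective
  have hm := h'.map_fun_eq_infinitePi_map fun (p : κ × ι) => hY p.2 p.1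
  simp only [hlaw] at hm
  have hc := Measure.infinitePi_map_curry (fun (_ : κ) (_ : ι) => γ)
  rw [← hm, Measure.map_map (by fun_prop) (by fun_prop)] at hc
  simp only [Measure.infinitePi_eq_pi] at hc
  exact hc

/-! ### The complex Gaussian law -/

theorem measurable_complex_mk : Measurable fun p : ℝ × ℝ => (⟨p.1, p.2⟩ : ℂ) :=
  Complex.measurableEquivRealProd.symm.measurable

instance : IsProbabilityMeasure complexGaussian :=
  Measure.isProbabilityMeasure_map measurable_complex_mk.aemeasurable

theorem charFun_complexGaussian (t : ℂ) :
    charFun complexGaussian t = Complex.exp (-(‖t‖ ^ 2 / 4 : ℝ)) := by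
  rw [charFun_apply, complexGaussian, integral_map measurable_complex_mk.aemeasurable
    (by fun_prop)]
  have h : ∀ p : ℝ × ℝ, Complex.exp ((inner ℝ (⟨p.1, p.2⟩ : ℂ) t : ℝ) * Complex.I)
      = Complex.exp (t.re * p.1 * Complex.I) * Complex.exp (t.im * p.2 * Complex.I) := by
    intro p
    rw [← Complex.exp_add, Complex.inner]
    congr 1
    simp
    ring
  simp_rw [h]
  rw [integral_prod_mul (f := fun x : ℝ => Complex.exp (t.re * x * Complex.I))
    (g := fun y : ℝ => Complex.exp (t.im * y * Complex.I)), ← charFun_apply_real,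
    ← charFun_apply_real, charFun_gaussianReal, charFun_gaussianReal, ← Complex.exp_add,
    Complex.sq_norm, Complex.normSq_apply]
  congr 1
  push_cast
  ring

theorem charFun_map_const_mul_complexGaussian (w t : ℂ) :
    charFun (complexGaussian.map (w * ·)) t = Complex.exp (-(‖w‖ ^ 2 * ‖t‖ ^ 2 / 4 : ℝ)) := by
  have h : charFun (complexGaussian.map (w * ·)) t = charFun complexGaussian (conj w * t) := by
    rw [charFun_apply, charFun_apply, integral_map (by fun_prop) (by fun_prop)]
    refine integral_congr_ae (ae_of_all _ fun z => ?_)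
    simp only [Complex.inner, map_mul]
    congr 4
    ring
  rw [h, charFun_complexGaussian, norm_mul, RCLike.norm_conj, mul_pow]

/-- Stability of the Gaussian law, by multiplying characteristic functions. Rotation invariance is
why only the moduli of the weights matter. -/
theorem map_sum_mul_pi_complexGaussian {ι : Type*} [Fintype ι] (w : ι → ℂ) :
    (Measure.pi fun _ : ι => complexGaussian).map (fun h => ∑ k, w k * h k) =
      complexGaussian.map ((√(∑ k, ‖w k‖ ^ 2) : ℂ) * ·) := by
  have hp : ∀ k, IsProbabilityMeasure (complexGaussian.map (w k * ·)) := fun k =>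
    Measure.isProbabilityMeasure_map (by fun_prop)
  have h1 : (Measure.pi fun _ : ι => complexGaussian).map (fun h => ∑ k, w k * h k) =
      (Measure.pi fun k => complexGaussian.map (w k * ·)).map (fun p => ∑ k, p k) := by
    rw [← Measure.pi_map_pi (fun k => by fun_prop), Measure.map_map (by fun_prop) (by fun_prop)]
    rfl
  have : IsProbabilityMeasure (complexGaussian.map ((√(∑ k, ‖w k‖ ^ 2) : ℂ) * ·)) :=
    Measure.isProbabilityMeasure_map (by fun_prop)
  have : IsProbabilityMeasure
      ((Measure.pi fun k => complexGaussian.map (w k * ·)).map (fun p => ∑ k, p k)) :=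
    Measure.isProbabilityMeasure_map (by fun_prop)
  rw [h1]
  refine Measure.ext_of_charFun ?_
  rw [charFun_map_sum_pi_eq_prod]
  ext t
  simp only [Finset.prod_apply, charFun_map_const_mul_complexGaussian]
  rw [← Complex.exp_sum, Complex.norm_real, Real.norm_of_nonneg (Real.sqrt_nonneg _),
    Real.sq_sqrt (by positivity), Finset.sum_mul, Finset.sum_div]
  push_cast
  rw [Finset.sum_neg_distrib]

instance : complexGaussian.IsOpenPosMeasure := by
  have h0 : (gaussianReal 0 (1 / 2)).IsOpenPosMeasure :=
    (gaussianReal_absolutelyContinuous' 0 (by simp)).isOpenPosMeasure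
  exact Complex.equivRealProdCLM.symm.continuous.isOpenPosMeasure_map
    Complex.equivRealProdCLM.symm.surjective

theorem memLp_id_complexGaussian (p : ℝ≥0) : MemLp id p complexGaussian := by
  rw [complexGaussian, memLp_map_measure_iff (by fun_prop) measurable_complex_mk.aemeasurable]
  have h := memLp_id_gaussianReal (μ := 0) (v := 1 / 2) p
  have h1 := (h.comp_fst (gaussianReal 0 (1 / 2))).ofReal (K := ℂ)
  have h2 := ((h.comp_snd (gaussianReal 0 (1 / 2))).ofReal (K := ℂ)).mul_const Complex.I
  refine (h1.add h2).ae_eq (ae_of_all _ fun p => ?_)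
  apply Complex.ext <;> simp

/-! ### Distribution of the received power -/

/-- The probability that the power `b * ‖z‖ ^ 2` received through a standard complex Gaussian
fading coefficient `z` does not exceed `t`. -/
noncomputable def powerCDF (t b : ℝ) : ℝ≥0∞ := complexGaussian {z | b * ‖z‖ ^ 2 ≤ t}

theorem powerCDF_le_one (t b : ℝ) : powerCDF t b ≤ 1 := prob_le_one

theorem powerCDF_antitone (t : ℝ) : Antitone (powerCDF t) := fun b c hbc =>
  measure_mono fun z (hz : c * ‖z‖ ^ 2 ≤ t) => show b * ‖z‖ ^ 2 ≤ t from
    (mul_le_mul_of_nonneg_right hbc (by positivity)).trans hz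

theorem measurable_powerCDF (t : ℝ) : Measurable (powerCDF t) :=
  (powerCDF_antitone t).measurable

theorem one_sub_powerCDF (t b : ℝ) :
    1 - powerCDF t b = complexGaussian {z | t < b * ‖z‖ ^ 2} := by
  have h : MeasurableSet {z : ℂ | b * ‖z‖ ^ 2 ≤ t} :=
    measurableSet_le (by fun_prop) (by fun_prop)
  rw [powerCDF, ← prob_compl_eq_one_sub h]
  congr 1
  ext z
  simp

theorem powerCDF_ne_zero {t : ℝ} (ht : 0 < t) (b : ℝ) : powerCDF t b ≠ 0 := by
  have h : IsOpen {z : ℂ | b * ‖z‖ ^ 2 < t} := isOpen_lt (by fun_prop) (by fun_prop)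
  have h0 := h.measure_ne_zero complexGaussian ⟨0, by simpa using ht⟩
  exact fun hz => h0 (measure_mono_null (fun z (hz : b * ‖z‖ ^ 2 < t) =>
    show b * ‖z‖ ^ 2 ≤ t from hz.le) hz)

theorem powerCDF_lt_one (t : ℝ) {b : ℝ} (hb : 0 < b) : powerCDF t b < 1 := by
  have h : IsOpen {z : ℂ | t < b * ‖z‖ ^ 2} := isOpen_lt (by fun_prop) (by fun_prop)
  have hn : {z : ℂ | t < b * ‖z‖ ^ 2}.Nonempty := by
    -- At this point the power `b * ‖z‖ ^ 2` equals `|t| + 1`.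
    refine ⟨(√((|t| + 1) / b) : ℂ), ?_⟩
    simp only [Set.mem_ofPred_eq, Complex.norm_real]
    rw [Real.norm_of_nonneg (Real.sqrt_nonneg _), Real.sq_sqrt (by positivity),
      mul_div_cancel₀ _ hb.ne']
    linarith [le_abs_self t]
  have h0 := h.measure_ne_zero complexGaussian hn
  rw [← one_sub_powerCDF] at h0
  exact tsub_pos_iff_lt.1 (pos_iff_ne_zero.2 h0)

theorem pi_complexGaussian_sum_mul_le {ι : Type*} [Fintype ι] (w : ι → ℂ) {P : ℝ} (t : ℝ) :
    (Measure.pi fun _ : ι => complexGaussian) {h | P * ‖∑ k, w k * h k‖ ^ 2 ≤ t} =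
      powerCDF t (P * ∑ k, ‖w k‖ ^ 2) := by
  have hS : MeasurableSet {z : ℂ | P * ‖z‖ ^ 2 ≤ t} :=
    measurableSet_le (by fun_prop) (by fun_prop)
  have h := congrArg (fun m : Measure ℂ => m {z : ℂ | P * ‖z‖ ^ 2 ≤ t})
    (map_sum_mul_pi_complexGaussian w)
  beta_reduce at h
  rw [Measure.map_apply (by fun_prop) hS, Measure.map_apply (by fun_prop) hS] at h
  refine h.trans ?_
  rw [powerCDF]
  congr 1
  ext z
  simp only [Set.mem_preimage, Set.mem_ofPred_eq, norm_mul, Complex.norm_real]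
  rw [Real.norm_of_nonneg (Real.sqrt_nonneg _), mul_pow, Real.sq_sqrt (by positivity), mul_assoc]

/-- By Tonelli, integrate over the location first: for fading `z` the locations in outage lie in a
disc of radius proportional to `‖z‖ ^ (2 / α)`. Its area is proportional to `‖z‖ ^ (4 / α)`, a
finite Gaussian moment for every `α > 0`. -/
theorem lintegral_one_sub_powerCDF_ne_top {α b t : ℝ} (hα : 0 < α) (hb : 0 < b) (ht : 0 < t)
    (s : Plane) : ∫⁻ x, (1 - powerCDF t (b * dist s x ^ (-α))) ≠ ∞ := by
  set S : Set (Plane × ℂ) := {p | t < b * dist s p.1 ^ (-α) * ‖p.2‖ ^ 2} with hSdef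
  have hS : MeasurableSet S := measurableSet_lt (by fun_prop) (by fun_prop)
  set C : ℝ := (b / t) ^ α⁻¹ with hC
  have hball : ∀ z : ℂ, (fun x => (x, z)) ⁻¹' S ⊆
      Metric.closedBall s (C * ‖z‖ ^ (2 / α)) := by
    intro z x hx
    have hx : t < b * dist s x ^ (-α) * ‖z‖ ^ 2 := hx
    rw [Metric.mem_closedBall, dist_comm]
    rcases (dist_nonneg (x := s) (y := x)).eq_or_lt with h0 | h0
    · rw [← h0]; positivity
    · rw [Real.rpow_neg h0.le, mul_right_comm, ← div_eq_mul_inv,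
        lt_div_iff₀ (Real.rpow_pos_of_pos h0 _)] at hx
      have h1 : dist s x ^ α ≤ b / t * ‖z‖ ^ 2 := by
        rw [div_mul_eq_mul_div, le_div_iff₀ ht, mul_comm]; exact hx.le
      calc dist s x = (dist s x ^ α) ^ α⁻¹ := (Real.rpow_rpow_inv h0.le hα.ne').symm
        _ ≤ (b / t * ‖z‖ ^ 2) ^ α⁻¹ := by gcongr
        _ = C * ‖z‖ ^ (2 / α) := by
          rw [Real.mul_rpow (by positivity) (by positivity), ← Real.rpow_natCast,
            ← Real.rpow_mul (norm_nonneg _), Nat.cast_ofNat, ← div_eq_mul_inv (2 : ℝ)]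
  refine ne_of_lt ?_
  calc ∫⁻ x, (1 - powerCDF t (b * dist s x ^ (-α)))
      = ((volume : Measure Plane).prod complexGaussian) S := by
        rw [Measure.prod_apply hS]
        refine lintegral_congr fun x => ?_
        rw [one_sub_powerCDF]
        rfl
    _ = ∫⁻ z, volume ((fun x => (x, z)) ⁻¹' S) ∂complexGaussian := Measure.prod_apply_symm hS
    _ ≤ ∫⁻ z, ENNReal.ofReal (C ^ 2) * volume (Metric.ball (0 : Plane) 1) *
          ‖z‖ₑ ^ (4 / α) ∂complexGaussian := by
        refine lintegral_mono fun z => (measure_mono (hball z)).trans_eq ?_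
        rw [Measure.addHaar_closedBall _ _ (by positivity), finrank_euclideanSpace_fin, mul_pow,
          ENNReal.ofReal_mul (by positivity), mul_right_comm, ← Real.rpow_natCast (‖z‖ ^ (2 / α)),
          ← Real.rpow_mul (norm_nonneg _), ← ofReal_norm,
          ENNReal.ofReal_rpow_of_nonneg (norm_nonneg _) (by positivity)]
        have h2 : 2 / α * (2 : ℕ) = 4 / α := by push_cast; ring
        rw [h2]
    _ < ∞ := by
        rw [lintegral_const_mul _ (by fun_prop)]
        refine ENNReal.mul_lt_top (ENNReal.mul_lt_top ENNReal.ofReal_lt_top measure_ball_lt_top) ?_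
        have h4 : 0 < 4 / α := by positivity
        have hm := (memLp_id_complexGaussian (4 / α).toNNReal).eLpNorm_lt_top
        have := lintegral_rpow_enorm_lt_top_of_eLpNorm_lt_top
          (by simpa using h4) ENNReal.coe_ne_top hm
        simpa [h4.le] using this

/-! ### Comparison at a single eavesdropper -/

theorem capacity_le_iff {γ R : ℝ} (hγ : 0 ≤ γ) : capacity γ ≤ R ↔ γ ≤ 2 ^ R - 1 := by
  rw [capacity, Real.logb_le_iff_le_rpow one_lt_two (by linarith), le_sub_iff_add_le, add_comm]

variable {K : ℕ} {α P : ℝ} {s : Fin K → Plane}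

theorem dbfSNR_nonneg (hP : 0 ≤ P) (ho hx : Fin K → ℂ) (x : Plane) :
    0 ≤ dbfSNR α P s ho hx x := by
  unfold dbfSNR; positivity

theorem fotSNR_nonneg (hP : 0 ≤ P) (hx : Fin K → ℂ) (x : Plane) (k : Fin K) :
    0 ≤ fotSNR α P s hx x k := by
  unfold fotSNR; positivity

/-- The smallest, over the base stations, of the probabilities that the FOT signal-to-noise ratio at
`x` does not exceed `t`. -/
noncomputable def minPowerCDF (α P t : ℝ) (s : Fin K → Plane) (x : Plane) : ℝ≥0∞ :=
  ⨅ k, powerCDF t (K * P * dist (s k) x ^ (-α))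

theorem measurable_minPowerCDF (t : ℝ) : Measurable (minPowerCDF α P t s) :=
  Measurable.iInf fun k => (measurable_powerCDF t).comp (by fun_prop)

theorem minPowerCDF_le_one [NeZero K] (t : ℝ) (x : Plane) : minPowerCDF α P t s x ≤ 1 :=
  (iInf_le _ 0).trans (powerCDF_le_one _ _)

theorem minPowerCDF_ne_zero [NeZero K] {t : ℝ} (ht : 0 < t) (x : Plane) :
    minPowerCDF α P t s x ≠ 0 := by
  obtain ⟨k, hk⟩ := exists_eq_ciInf_of_finite
    (f := fun k => powerCDF t (K * P * dist (s k) x ^ (-α)))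
  rw [minPowerCDF, ← hk]
  exact powerCDF_ne_zero ht _

theorem lintegral_one_sub_minPowerCDF_ne_top [NeZero K] {t : ℝ} (hα : 0 < α) (hP : 0 < P)
    (ht : 0 < t) : ∫⁻ x, (1 - minPowerCDF α P t s x) ≠ ∞ := by
  have hK : (0 : ℝ) < K := Nat.cast_pos.2 (NeZero.pos K)
  refine ne_top_of_le_ne_top (b := ∑ k, ∫⁻ x, (1 - powerCDF t (K * P * dist (s k) x ^ (-α)))) ?_ ?_
  · exact ENNReal.sum_ne_top.2 fun k _ =>
      lintegral_one_sub_powerCDF_ne_top hα (mul_pos hK hP) ht (s k)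
  · rw [← lintegral_finsetSum (f := fun k x => 1 - powerCDF t (K * P * dist (s k) x ^ (-α))) _
      fun k _ => measurable_const.sub ((measurable_powerCDF t).comp (by fun_prop))]
    refine lintegral_mono fun x => ?_
    -- The minimum is attained, so `1 - minPowerCDF` is one of the nonnegative summands.
    obtain ⟨k, hk⟩ := exists_eq_ciInf_of_finite
      (f := fun k => powerCDF t (K * P * dist (s k) x ^ (-α)))
    rw [minPowerCDF, ← hk]
    exact Finset.single_le_sum (f := fun k => 1 - powerCDF t (K * P * dist (s k) x ^ (-α)))
      (fun _ _ => zero_le) (Finset.mem_univ k)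

theorem minPowerCDF_le_dbf [NeZero K] (hP : 0 ≤ P) (t : ℝ) (ho : Fin K → ℂ) (x : Plane) :
    minPowerCDF α P t s x ≤
      (Measure.pi fun _ : Fin K => complexGaussian) {h | dbfSNR α P s ho h x ≤ t} := by
  set w : Fin K → ℂ := fun k => conj (ho k) / (‖ho k‖ : ℂ) * ((dist (s k) x ^ (-α / 2) : ℝ) : ℂ)
    with hw
  have h1 : {h | dbfSNR α P s ho h x ≤ t} = {h | P * ‖∑ k, w k * h k‖ ^ 2 ≤ t} := by
    ext h
    have h2 : ∀ k, conj (ho k) * h k / (‖ho k‖ : ℂ) * ((dist (s k) x ^ (-α / 2) : ℝ) : ℂ) =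
        w k * h k := fun k => by rw [hw]; ring
    simp only [Set.mem_ofPred_eq, dbfSNR, h2]
  have h3 : ∀ k, ‖w k‖ ^ 2 ≤ dist (s k) x ^ (-α) := fun k => by
    -- Only an inequality: the quotient is `0` when `ho k = 0`. A bound suffices, and no null set
    -- has to be removed.
    have h4 : ‖conj (ho k) / (‖ho k‖ : ℂ)‖ ≤ 1 := by
      rw [norm_div, RCLike.norm_conj, Complex.norm_real, norm_norm]
      exact div_self_le_one _
    have h5 : (dist (s k) x ^ (-α / 2)) ^ 2 = dist (s k) x ^ (-α) := by
      rw [← Real.rpow_natCast, ← Real.rpow_mul dist_nonneg]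
      congr 1
      push_cast
      ring
    rw [hw, norm_mul, mul_pow, Complex.norm_real, Real.norm_eq_abs, sq_abs, h5]
    exact mul_le_of_le_one_left (by positivity) (pow_le_one₀ (norm_nonneg _) h4)
  obtain ⟨k₀, hk₀⟩ := Finite.exists_max fun k => dist (s k) x ^ (-α)
  rw [h1, pi_complexGaussian_sum_mul_le]
  refine (iInf_le _ k₀).trans (powerCDF_antitone t ?_)
  rw [mul_comm (K : ℝ), mul_assoc]
  refine mul_le_mul_of_nonneg_left ?_ hP
  calc ∑ k, ‖w k‖ ^ 2 ≤ ∑ _k : Fin K, dist (s k₀) x ^ (-α) :=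
        Finset.sum_le_sum fun k _ => (h3 k).trans (hk₀ k)
    _ = K * dist (s k₀) x ^ (-α) := by simp

theorem pi_complexGaussian_fot (t : ℝ) (x : Plane) :
    (Measure.pi fun _ : Fin K => complexGaussian) {h | ∀ k, fotSNR α P s h x k ≤ t} =
      ∏ k, powerCDF t (K * P * dist (s k) x ^ (-α)) := by
  simp only [powerCDF]
  rw [← Measure.pi_pi]
  congr 1
  ext h
  simp only [Set.mem_ofPred_eq, Set.mem_pi, Set.mem_univ, forall_true_left, fotSNR]
  exact forall_congr' fun k => by rw [mul_right_comm]

theorem fot_le_minPowerCDF (t : ℝ) (x : Plane) :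
    (Measure.pi fun _ : Fin K => complexGaussian) {h | ∀ k, fotSNR α P s h x k ≤ t} ≤
      minPowerCDF α P t s x := by
  rw [pi_complexGaussian_fot]
  refine le_iInf fun k => ?_
  rw [← Finset.mul_prod_erase _ _ (Finset.mem_univ k)]
  exact mul_le_of_le_one_right' (Finset.prod_le_one' fun _ _ => powerCDF_le_one _ _)

theorem fot_lt_minPowerCDF (hK : 2 ≤ K) (hP : 0 < P) {t : ℝ} (ht : 0 < t) {x : Plane}
    (hx : ∀ k, x ≠ s k) :
    (Measure.pi fun _ : Fin K => complexGaussian) {h | ∀ k, fotSNR α P s h x k ≤ t} <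
      minPowerCDF α P t s x := by
  have : NeZero K := ⟨by omega⟩
  have : Nontrivial (Fin K) := Fin.nontrivial_iff_two_le.2 hK
  have hK0 : (0 : ℝ) < K := by positivity
  rw [pi_complexGaussian_fot]
  obtain ⟨k, hk⟩ := exists_eq_ciInf_of_finite
    (f := fun k => powerCDF t (K * P * dist (s k) x ^ (-α)))
  obtain ⟨l, hl⟩ := exists_ne k
  rw [minPowerCDF, ← hk, ← Finset.mul_prod_erase _ _ (Finset.mem_univ k),
    ← Finset.mul_prod_erase _ _ (Finset.mem_erase.2 ⟨hl, Finset.mem_univ l⟩)]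
  -- This is where `x` must avoid the base stations: for `α ≠ 0` the convention `0 ^ (-α) = 0` would
  -- make this factor equal to one.
  have hlt : powerCDF t (K * P * dist (s l) x ^ (-α)) < 1 :=
    powerCDF_lt_one t (mul_pos (mul_pos hK0 hP)
      (Real.rpow_pos_of_pos (dist_pos.2 (hx l).symm) _))
  calc _ ≤ powerCDF t (K * P * dist (s k) x ^ (-α)) *
          powerCDF t (K * P * dist (s l) x ^ (-α)) := by
        gcongr
        exact mul_le_of_le_one_right' (Finset.prod_le_one' fun _ _ => powerCDF_le_one _ _)
    _ < powerCDF t (K * P * dist (s k) x ^ (-α)) * 1 :=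
        ENNReal.mul_lt_mul_right (powerCDF_ne_zero ht _)
          ((powerCDF_le_one _ _).trans_lt ENNReal.one_lt_top).ne hlt
    _ = _ := mul_one _

/-! ### Comparison for fixed eavesdropper locations -/

theorem measurable_dbfSNR : Measurable fun p : (Fin K → ℂ) × (Fin K → ℂ) × Plane =>
    dbfSNR α P s p.1 p.2.1 p.2.2 := by
  unfold dbfSNR
  fun_prop

theorem measurable_fotSNR (k : Fin K) : Measurable fun p : (Fin K → ℂ) × Plane =>
    fotSNR α P s p.1 p.2 k := by
  unfold fotSNR
  fun_prop

/-- For fixed eavesdropper locations, the probability that FOT has no secrecy outage is smaller than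
the product of the `minPowerCDF`s. -/
theorem fot_noOutage_lt (hK : 2 ≤ K) (hP : 0 < P) {t : ℝ} (ht : 0 < t) {x : ℕ → Plane}
    (hx : ∀ k, x 0 ≠ s k) (hsum : ∑' j, (1 - minPowerCDF α P t s (x j)) ≠ ∞) :
    (Measure.infinitePi fun _ : ℕ => Measure.pi fun _ : Fin K => complexGaussian)
      {h | ∀ j k, fotSNR α P s (h j) (x j) k ≤ t} <
      ⨅ n, ∏ j ∈ Finset.range n, minPowerCDF α P t s (x j) := by
  have : NeZero K := ⟨by omega⟩
  have hset : {h : ℕ → Fin K → ℂ | ∀ j k, fotSNR α P s (h j) (x j) k ≤ t} =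
      Set.univ.pi fun j => {h | ∀ k, fotSNR α P s h (x j) k ≤ t} := by
    ext h; simp
  have hm : ∀ j, MeasurableSet {h : Fin K → ℂ | ∀ k, fotSNR α P s h (x j) k ≤ t} := fun j => by
    rw [Set.ofPred_forall]
    exact MeasurableSet.iInter fun k => measurableSet_le
      ((measurable_fotSNR k).comp (f := fun h : Fin K → ℂ => (h, x j)) (by fun_prop))
      measurable_const
  rw [hset, infinitePi_univ_pi_eq_iInf _ hm]
  exact iInf_prod_lt_iInf_prod (fun j => fot_le_minPowerCDF t (x j))
    (fot_lt_minPowerCDF hK hP ht hx) (fun j => minPowerCDF_le_one t (x j))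
    (fun j => minPowerCDF_ne_zero ht (x j)) hsum

/-- For fixed eavesdropper locations and fixed fading to the user, the probability that DBF has no
secrecy outage is at least the product of the `minPowerCDF`s. -/
theorem le_dbf_noOutage [NeZero K] (hP : 0 ≤ P) (t : ℝ) (ho : Fin K → ℂ) (x : ℕ → Plane) :
    ⨅ n, ∏ j ∈ Finset.range n, minPowerCDF α P t s (x j) ≤
      (Measure.infinitePi fun _ : ℕ => Measure.pi fun _ : Fin K => complexGaussian)
        {h | ∀ j, dbfSNR α P s ho (h j) (x j) ≤ t} := by
  have hset : {h : ℕ → Fin K → ℂ | ∀ j, dbfSNR α P s ho (h j) (x j) ≤ t} =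
      Set.univ.pi fun j => {h | dbfSNR α P s ho h (x j) ≤ t} := by
    ext h; simp
  have hm : ∀ j, MeasurableSet {h : Fin K → ℂ | dbfSNR α P s ho h (x j) ≤ t} := fun j =>
    measurableSet_le (measurable_dbfSNR.comp
      (f := fun h : Fin K → ℂ => (ho, h, x j)) (by fun_prop))
      measurable_const
  rw [hset, infinitePi_univ_pi_eq_iInf _ hm]
  exact iInf_mono fun n => Finset.prod_le_prod' fun j _ => minPowerCDF_le_dbf hP t ho (x j)

theorem measurableSet_dbf_noOutage (t : ℝ) :
    MeasurableSet {p : (ℕ → Plane) × ((Fin K → ℂ) × (ℕ → Fin K → ℂ)) |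
      ∀ j, dbfSNR α P s p.2.1 (p.2.2 j) (p.1 j) ≤ t} := by
  rw [Set.ofPred_forall]
  refine MeasurableSet.iInter fun j => measurableSet_le ?_ measurable_const
  exact measurable_dbfSNR.comp (f := fun p : (ℕ → Plane) × ((Fin K → ℂ) × (ℕ → Fin K → ℂ)) =>
    (p.2.1, p.2.2 j, p.1 j)) (by fun_prop)

theorem measurableSet_fot_noOutage (t : ℝ) :
    MeasurableSet {p : (ℕ → Plane) × ((Fin K → ℂ) × (ℕ → Fin K → ℂ)) |
      ∀ j k, fotSNR α P s (p.2.2 j) (p.1 j) k ≤ t} := by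
  simp_rw [Set.ofPred_forall]
  refine MeasurableSet.iInter fun j => MeasurableSet.iInter fun k =>
    measurableSet_le ?_ measurable_const
  exact (measurable_fotSNR k).comp (f := fun p : (ℕ → Plane) × ((Fin K → ℂ) × (ℕ → Fin K → ℂ)) =>
    (p.2.2 j, p.1 j)) (by fun_prop)

/-! ### Almost sure properties of the locations -/

theorem IsPoissonPointProcess.ae_tsum_ne_top {Ω : Type*} [MeasurableSpace Ω] {μ : Measure Ω}
    {Λ : Measure Plane} [SigmaFinite Λ] {e : ℕ → Ω → Plane} (he : ∀ j, Measurable (e j))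
    (h : IsPoissonPointProcess (fun ω => pointMeasure (fun j => e j ω)) Λ μ) {f : Plane → ℝ≥0∞}
    (hf : Measurable f) (hfi : ∫⁻ x, f x ∂Λ ≠ ∞) : ∀ᵐ ω ∂μ, ∑' j, f (e j ω) ≠ ∞ := by
  have h1 : ∫⁻ ω, ∑' j, f (e j ω) ∂μ = ∫⁻ x, f x ∂Λ := by
    rw [lintegral_tsum (f := fun j ω => f (e j ω)) fun j => (hf.comp (he j)).aemeasurable,
      ← h.sum_map_eq he,
      lintegral_sum_measure]
    exact tsum_congr fun j => (lintegral_map hf (he j)).symm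
  filter_upwards [ae_lt_top (Measurable.tsum fun j => hf.comp (he j))
    (h1.trans_ne hfi)] with ω hω using hω.ne

theorem IsPoissonPointProcess.ae_ne {Ω : Type*} [MeasurableSpace Ω] {μ : Measure Ω}
    {Λ : Measure Plane} [SigmaFinite Λ] {e : ℕ → Ω → Plane}
    (he : ∀ j, Measurable (e j))
    (h : IsPoissonPointProcess (fun ω => pointMeasure (fun j => e j ω)) Λ μ) (j : ℕ) {x : Plane}
    (hx : Λ {x} = 0) :
    ∀ᵐ ω ∂μ, e j ω ≠ x := by
  have h1 : ∀ᵐ y ∂Λ, y ≠ x := by simpa [ae_iff] using hx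
  rw [← h.sum_map_eq he] at h1
  exact ae_of_ae_map (he j).aemeasurable (Measure.ae_sum_iff.1 h1 j)

end SecureCaching

/-! ### Averaging over the locations -/

open SecureCaching in
theorem proposition2 {Ω : Type*} [MeasurableSpace Ω] (μ : Measure Ω) [IsProbabilityMeasure μ]
    -- number of base stations, path-loss exponent, normalized power, rate redundancy, density
    (K : ℕ) (hK : 2 ≤ K) (α P Re lam : ℝ) (hα : 0 < α) (hP : 0 < P) (hRe : 0 < Re) (hlam : 0 < lam)
    -- locations of the base stations
    (s : Fin K → SecureCaching.Plane)
    -- locations of the eavesdroppers: a homogeneous Poisson point process of density `lam`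
    (e : ℕ → Ω → SecureCaching.Plane) (he_meas : ∀ j, Measurable (e j))
    (hPPP : SecureCaching.IsPoissonPointProcess
      (fun ω => SecureCaching.pointMeasure (fun j => e j ω))
      (ENNReal.ofReal lam • (volume : Measure SecureCaching.Plane)) μ)
    -- fading coefficients to the user (`ho k`) and to the eavesdroppers (`he k j`)
    (ho : Fin K → Ω → ℂ) (he : Fin K → ℕ → Ω → ℂ)
    (hho_meas : ∀ k, Measurable (ho k)) (hhe_meas : ∀ k j, Measurable (he k j))
    (hho_law : ∀ k, μ.map (ho k) = SecureCaching.complexGaussian)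
    (hhe_law : ∀ k j, μ.map (he k j) = SecureCaching.complexGaussian)
    -- all fading coefficients are mutually independent ...
    (hfading : iIndepFun
      (Sum.elim ho (fun p : Fin K × ℕ => he p.1 p.2) : Fin K ⊕ Fin K × ℕ → Ω → ℂ) μ)
    -- ... and jointly independent of the locations of the eavesdroppers
    (hindep : IndepFun (fun ω j => e j ω)
      (fun ω (i : Fin K ⊕ Fin K × ℕ) => Sum.elim (fun k => ho k ω) (fun p => he p.1 p.2 ω) i) μ) :
    SecureCaching.dbfSOP μ α P Re s e ho he < SecureCaching.fotSOP μ α P Re s e he := by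
  have : NeZero K := ⟨by omega⟩
  have : SigmaFinite (ENNReal.ofReal lam • (volume : Measure Plane)) :=
    inferInstanceAs (SigmaFinite (lam.toNNReal • (volume : Measure Plane)))
  set t : ℝ := 2 ^ Re - 1
  have ht : 0 < t := sub_pos.2 (Real.one_lt_rpow one_lt_two hRe)
  set ν := Measure.infinitePi fun _ : ℕ => Measure.pi fun _ : Fin K => complexGaussian
  set ρ := μ.map fun ω k => ho k ω
  have : IsProbabilityMeasure ρ := Measure.isProbabilityMeasure_map (by fun_prop)
  set X : Ω → ℕ → Plane := fun ω j => e j ω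
  have hX : Measurable X := by fun_prop
  set Y : Ω → (Fin K → ℂ) × (ℕ → Fin K → ℂ) := fun ω => (fun k => ho k ω, fun j k => he k j ω)
  have hY : Measurable Y := by fun_prop
  have hYlaw : μ.map Y = ρ.prod ν := by
    have h1 := iIndepFun.indepFun_inl_inr hho_meas (fun p : Fin K × ℕ => hhe_meas p.1 p.2) hfading
    have h2 : IndepFun (fun ω k => ho k ω) (fun ω j k => he k j ω) μ :=
      h1.comp (φ := id) (ψ := fun (v : Fin K × ℕ → ℂ) (j : ℕ) (k : Fin K) => v (k, j))
        measurable_id (by fun_prop)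
    rw [h2.map_prod_eq_prod_map_map (by fun_prop) (by fun_prop),
      iIndepFun.map_swap_eq_infinitePi hhe_meas hhe_law (hfading.precomp Sum.inr_injective)]
  have hXY : IndepFun X Y μ :=
    hindep.comp (φ := id) (ψ := fun (v : Fin K ⊕ Fin K × ℕ → ℂ) =>
      (fun k : Fin K => v (Sum.inl k), fun (j : ℕ) (k : Fin K) => v (Sum.inr (k, j))))
      measurable_id (by fun_prop)
  set D := {p : (ℕ → Plane) × ((Fin K → ℂ) × (ℕ → Fin K → ℂ)) |
      ∀ j, dbfSNR α P s p.2.1 (p.2.2 j) (p.1 j) ≤ t}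
  set F := {p : (ℕ → Plane) × ((Fin K → ℂ) × (ℕ → Fin K → ℂ)) |
      ∀ j k, fotSNR α P s (p.2.2 j) (p.1 j) k ≤ t}
  have hD : MeasurableSet D := measurableSet_dbf_noOutage t
  have hF : MeasurableSet F := measurableSet_fot_noOutage t
  have hDge : ∀ x : ℕ → Plane, ⨅ n, ∏ j ∈ Finset.range n, minPowerCDF α P t s (x j) ≤
      ρ.prod ν (Prod.mk x ⁻¹' D) := fun x => by
    -- The lower bound is uniform in the fading `o` to the user, so it survives averaging over the
    -- probability measure `ρ`.
    rw [Measure.prod_apply (measurable_prodMk_left hD)]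
    refine le_trans ?_ (lintegral_mono fun o => le_dbf_noOutage hP.le t o x)
    simp
  have hFeq : ∀ x : ℕ → Plane, ρ.prod ν (Prod.mk x ⁻¹' F) =
      ν {h | ∀ j k, fotSNR α P s (h j) (x j) k ≤ t} := fun x => by
    have h1 : Prod.mk x ⁻¹' F =
        Set.univ ×ˢ {h | ∀ j k, fotSNR α P s (h j) (x j) k ≤ t} := by
      ext p; simp [F]
    rw [h1, Measure.prod_prod, measure_univ, one_mul]
  have hlt : ∀ᵐ x ∂(μ.map X), ρ.prod ν (Prod.mk x ⁻¹' F) < ρ.prod ν (Prod.mk x ⁻¹' D) := by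
    rw [ae_map_iff hX.aemeasurable (measurableSet_lt (measurable_measure_prodMk_left hF)
      (measurable_measure_prodMk_left hD))]
    have hsum := hPPP.ae_tsum_ne_top he_meas (f := fun x => 1 - minPowerCDF α P t s x)
      (measurable_const.sub (measurable_minPowerCDF t)) (by
        rw [lintegral_smul_measure]
        exact ENNReal.mul_ne_top ENNReal.ofReal_ne_top
          (lintegral_one_sub_minPowerCDF_ne_top hα hP ht))
    filter_upwards [hsum, ae_all_iff.2 fun k => hPPP.ae_ne he_meas 0
      (x := s k) (by simp)] with ω h1 h2
    rw [hFeq]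
    exact (fot_noOutage_lt hK hP ht h2 h1).trans_le (hDge _)
  have key : μ {ω | (X ω, Y ω) ∈ F} < μ {ω | (X ω, Y ω) ∈ D} := by
    rw [IndepFun.measure_preimage_prodMk hX hY hXY hF,
      IndepFun.measure_preimage_prodMk hX hY hXY hD, hYlaw]
    have : IsProbabilityMeasure (μ.map X) := Measure.isProbabilityMeasure_map hX.aemeasurable
    -- An almost sure strict inequality integrates to a strict one, since the smaller integral is
    -- finite.
    refine lintegral_strict_mono (IsProbabilityMeasure.ne_zero _)
      (measurable_measure_prodMk_left hD).aemeasurable ?_ hlt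
    exact ne_top_of_le_ne_top ENNReal.one_ne_top
      ((lintegral_mono fun x => prob_le_one).trans (by simp))
  have hdbf : dbfSOP μ α P Re s e ho he = 1 - μ.real {ω | (X ω, Y ω) ∈ D} := by
    have h1 : MeasurableSet {ω | (X ω, Y ω) ∈ D} := (hX.prodMk hY) hD
    rw [← probReal_compl_eq_one_sub h1, dbfSOP]
    congr 1
    ext ω
    simp only [Set.mem_ofPred_eq, Set.mem_compl_iff, D, not_forall, X, Y]
    exact exists_congr fun j => by
      rw [← capacity_le_iff (dbfSNR_nonneg hP.le _ _ _), not_le]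
  have hfot : fotSOP μ α P Re s e he = 1 - μ.real {ω | (X ω, Y ω) ∈ F} := by
    rw [fotSOP]
    congr 2
    ext ω
    exact forall₂_congr fun j k => capacity_le_iff (fotSNR_nonneg hP.le _ _ _)
  rw [hdbf, hfot]
  exact sub_lt_sub_left
    ((ENNReal.toReal_lt_toReal (measure_ne_top _ _) (measure_ne_top _ _)).2 key) 1
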